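/- Let $X$ be a locally coherent scheme, i.e. a scheme such that for every affine open $U\subseteq X$ the ring $\mathcal{O}_X(U)$ is coherent (every finitely generated ideal is finitely presented), and let $\mathscr{F}$ be a quasi-coherent $\mathcal{O}_X$-module. Then the following are equivalent. (1) $\mathscr{F}$ is locally absolutely pure: for every affine open $U\subseteq X$ the $\mathcal{O}_X(U)$-module $A=\mathscr{F}(U)$ is absolutely pure, i.e. for every injective $\mathcal{O}_X(U)$-linear map $A\to B$ and every $\mathcal{O}_X(U)$-module $T$ the map $T\otimes_{\mathcal{O}_X(U)}A\to T\otimes_{\mathcal{O}_X(U)}B$ is injective. (2) $\mathscr{F}$ is absolutely pure in the category $\mathcal{O}_X\text{-Mod}$ of all sheaves of $\mathcal{O}_X$-modules: for every monomorphism $\tau:\mathscr{F}\to\mathscr{G}$ in $\mathcal{O}_X\text{-Mod}$ and every $\mathscr{M}\in\mathcal{O}_X\text{-Mod}$ the morphism $\mathrm{id}\otimes\tau:\mathscr{M}\otimes_{\mathcal{O}_X}\mathscr{F}\to\mathscr{M}\otimes_{\mathcal{O}_X}\mathscr{G}$ is a monomorphism, where $\otimes_{\mathcal{O}_X}$ is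 the sheafification of the sectionwise tensor product. -/

import Mathlib

universe u

/-- An `R`-linear map `f : A → B` is pure if `T ⊗ A → T ⊗ B` is injective for every `R`-module `T`
(taking `T = R`, such an `f` is itself injective). -/
def LinearMap.IsTensorPure {R A B : Type u} [CommRing R] [AddCommGroup A] [Module R A]
    [AddCommGroup B] [Module R B] (f : A →ₗ[R] B) : Prop :=
  ∀ (T : Type u) [AddCommGroup T] [Module R T], Function.Injective (f.lTensor T)

/-- An `R`-module is absolutely pure if it is pure in every module containing it. -/
def Module.IsAbsolutelyPure (R A : Type u) [CommRing R] [AddCommGroup A] [Module R A] : Prop :=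
  ∀ (B : Type u) [AddCommGroup B] [Module R B] (f : A →ₗ[R] B),
    Function.Injective f → f.IsTensorPure

/-- A commutative ring is coherent if each of its finitely generated ideals is finitely
presented as a module. -/
def IsCoherentCommRing (R : Type u) [CommRing R] : Prop :=
  ∀ I : Ideal R, I.FG → Module.FinitePresentation R I

namespace AlgebraicGeometry.Scheme

open CategoryTheory MonoidalCategory

/-- A scheme is locally coherent if `𝒪_X(U)` is a coherent ring for each affine open `U`. -/
def IsLocallyCoherent (X : Scheme.{u}) : Prop :=
  ∀ U : X.Opens, IsAffineOpen U → IsCoherentCommRing Γ(X, U)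

namespace Modules

variable {X : Scheme.{u}}

/-- The presheaf tensor product functor `G ↦ (U ↦ M(U) ⊗_{𝒪_X(U)} G(U))`. -/
noncomputable def presheafTensorLeft (M : X.PresheafOfModules) :
    X.PresheafOfModules ⥤ X.PresheafOfModules :=
  tensorLeft (C := _root_.PresheafOfModules.{u} (X.presheaf ⋙ forget₂ CommRingCat RingCat)) M

/-- The functor `M ⊗ -` on `𝒪_X`-modules: the sheafification of the presheaf tensor product. -/
noncomputable def tensorLeftFunctor (M : X.Modules) : X.Modules ⥤ X.Modules :=
  toPresheafOfModules X ⋙ presheafTensorLeft ((toPresheafOfModules X).obj M) ⋙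
    _root_.PresheafOfModules.sheafification (𝟙 X.ringCatSheaf.obj)

/-- The sequence `0 ⟶ F ⟶ G` given by `τ` is pure exact in `𝒪_X`-modules: it is exact and stays
exact after applying `M ⊗ -` for every `𝒪_X`-module `M`. -/
def IsPureExact {F G : X.Modules} (τ : F ⟶ G) : Prop :=
  Mono τ ∧ ∀ M : X.Modules, Mono (M.tensorLeftFunctor.map τ)

/-- `F` is absolutely pure in the category of all `𝒪_X`-modules. -/
def IsAbsolutelyPure (F : X.Modules) : Prop :=
  ∀ (G : X.Modules) (τ : F ⟶ G), Mono τ → IsPureExact τ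

/-- `F(U)` is absolutely pure over `𝒪_X(U)` for every affine open `U`. -/
def IsLocallyAbsolutelyPure (F : X.Modules) : Prop :=
  ∀ U : X.Opens, IsAffineOpen U → Module.IsAbsolutelyPure Γ(X, U) Γ(F, U)

end Modules

end AlgebraicGeometry.Scheme

/-! From local to global: a section killed by `id ⊗ τ` is restricted to affine opens, where `F` is
absolutely pure and `τ` is injective on sections, so it vanishes locally; this is what a
monomorphism after sheafification requires. Conversely, let `t ∈ T ⊗ F(U)` die in `T ⊗ B`, with `U`
affine and `F(U) ⊆ B`. Since the test sheaves need not be quasi-coherent, products of skyscrapers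
suffice. By flatness `F_x` embeds in the localization of `B` at each `x ∈ U`; `exists_extension` and
`toPiSkyscraper` assemble these into a mono out of `F` which on `U` factors through `B`. Tensoring
with the product of skyscrapers of the localizations of `T`, purity makes the image of `t` vanish
near each `x`. Evaluating at `x`, `t` vanishes in the localization of `T ⊗ F(U)`
(`exists_semilinearMap`), so its annihilator lies in no prime and `t = 0`. -/

section

open CategoryTheory TopologicalSpace Opposite TensorProduct

/-! ### Localization of modules and tensor products -/

section Localization

variable {R S A A' : Type u} [CommRing R] [CommRing S] [AddCommGroup A] [Module R A]
  [AddCommGroup A'] [Module S A'] {ρ : R →+* S} (m : Submonoid R)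
  (g : A →ₛₗ[ρ] A')

/-- Data exhibiting `g : A → A'` as a localization of modules at `m` over a localization of
rings `ρ : R → S`. -/
structure LinearMap.IsLocalizationAt : Prop where
  isLocalization : letI := ρ.toAlgebra; IsLocalization m S
  surj : ∀ y, ∃ s ∈ m, ∃ a, ρ s • y = g a
  exists_smul_eq_zero : ∀ a, g a = 0 → ∃ s ∈ m, s • a = 0

variable {m g}

namespace LinearMap.IsLocalizationAt

lemma isLocalizedModule (h : g.IsLocalizationAt m) :
    letI := Module.compHom A' ρ
    IsLocalizedModule m ({ __ := g, map_smul' := g.map_smulₛₗ } : A →ₗ[R] A') := by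
  let := ρ.toAlgebra
  let := Module.compHom A' ρ
  have : IsScalarTower R S A' := .of_algebraMap_smul fun _ _ ↦ rfl
  have := h.isLocalization
  refine ⟨fun s ↦ ?_, fun y ↦ ?_, fun {a b} hab ↦ ?_⟩
  · rw [Module.End.isUnit_iff]
    have hu := (IsLocalization.map_units S s).map (algebraMap S (Module.End S A'))
    rw [Module.End.isUnit_iff] at hu
    exact hu
  · obtain ⟨s, hs, a, ha⟩ := h.surj y
    exact ⟨(a, ⟨s, hs⟩), ha⟩
  · obtain ⟨s, hs, e⟩ := h.exists_smul_eq_zero (a - b) (by rw [map_sub]; exact sub_eq_zero.2 hab)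
    exact ⟨⟨s, hs⟩, by rw [smul_sub] at e; exact sub_eq_zero.1 e⟩

/-- An injection out of `A` extends to an injection of `S`-modules out of the localization. -/
lemma exists_extension (h : g.IsLocalizationAt m) {B : Type u}
    [AddCommGroup B] [Module R B] (ι : A →ₗ[R] B) (hι : Function.Injective ι) :
    ∃ (N : ModuleCat.{u} S) (φ : A' →ₗ[S] N) (β : B →ₛₗ[ρ] N), Function.Injective φ ∧
      ∀ a, β (ι a) = φ (g a) := by
  let := ρ.toAlgebra
  let := Module.compHom A' ρ
  have : IsScalarTower R S A' := .of_algebraMap_smul fun _ _ ↦ rfl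
  have := h.isLocalization
  have := h.isLocalizedModule
  have := IsLocalization.flat S m
  have hb := IsLocalizedModule.isBaseChange m S
    ({ __ := g, map_smul' := g.map_smulₛₗ } : A →ₗ[R] A')
  refine ⟨ModuleCat.of S (S ⊗[R] B), ι.baseChange S ∘ₗ hb.equiv.symm.toLinearMap,
    { toFun b := 1 ⊗ₜ b, map_add' := tmul_add _, map_smul' := fun r b ↦ ?_ }, ?_, fun a ↦ ?_⟩
  · rw [← smul_tmul, Algebra.smul_def, smul_tmul', smul_eq_mul]
    rfl
  -- `A'` is `S ⊗ A`, and the localization `S` is flat over `R`.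
  · exact (Module.Flat.lTensor_preserves_injective_linearMap (M := S) ι hι).comp
      hb.equiv.symm.injective
  · change (1 : S) ⊗ₜ[R] ι a = ι.baseChange S (hb.equiv.symm (g a))
    erw [hb.equiv_symm_apply a]
    simp

/-- Elements of `T ⊗ A` that vanish in the tensor product with the localization of `A` are killed
by an element of `m`. -/
lemma exists_semilinearMap (h : g.IsLocalizationAt m) (T : Type u)
    [AddCommGroup T] [Module R T] :
    ∃ (T' : ModuleCat.{u} S) (θ : T →ₛₗ[ρ] T'), ∀ t : T ⊗[R] A,
      TensorProduct.map θ g t = 0 → ∃ s ∈ m, s • t = 0 := by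
  let := ρ.toAlgebra
  let := Module.compHom A' ρ
  have : IsScalarTower R S A' := .of_algebraMap_smul fun _ _ ↦ rfl
  have := h.isLocalization
  have := h.isLocalizedModule
  let g' : A →ₗ[R] A' := { __ := g, map_smul' := g.map_smulₛₗ }
  let θ : T →ₛₗ[ρ] S ⊗[R] T :=
    { toFun b := 1 ⊗ₜ b, map_add' := tmul_add _, map_smul' := fun r b ↦ by
        rw [← smul_tmul, Algebra.smul_def, smul_tmul', smul_eq_mul]
        rfl }
  -- Under `(S ⊗ T) ⊗_S A' ≃ A' ⊗_R T`, the map `θ ⊗ g` becomes `g ⊗ T`, again a localization at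
  -- `m`.
  have key (t : T ⊗[R] A) : AlgebraTensorModule.cancelBaseChange R S S A' T
      (TensorProduct.comm S _ _ (TensorProduct.map θ g t)) =
        AlgebraTensorModule.rTensor R T g' (TensorProduct.comm R _ _ t) := by
    induction t with
    | zero => simp
    | add a b ha hb => simp only [map_add, ha, hb]
    | tmul a b =>
      simp only [TensorProduct.map_tmul, TensorProduct.comm_tmul]
      erw [AlgebraTensorModule.cancelBaseChange_tmul]
      rw [one_smul]
      rfl
  refine ⟨ModuleCat.of S (S ⊗[R] T), θ, fun t ht ↦ ?_⟩
  have ht' := key t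
  erw [ht, map_zero] at ht'
  obtain ⟨s, hs⟩ := (IsLocalizedModule.eq_zero_iff m (AlgebraTensorModule.rTensor R T g')).1 ht'.symm
  refine ⟨s, s.2, (TensorProduct.comm R T A).injective ?_⟩
  rw [map_smul, map_zero]
  exact hs

end LinearMap.IsLocalizationAt

end Localization

/-! ### Monomorphisms and tensor products of sheaves of modules -/

namespace AlgebraicGeometry.Scheme.Modules

variable {X : Scheme.{u}}

/-- The action of a morphism of `𝒪_X`-modules on sections, as a linear map. -/
noncomputable def Hom.appLinear {F G : X.Modules} (τ : F ⟶ G) (U : X.Opens) :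
    Γ(F, U) →ₗ[Γ(X, U)] Γ(G, U) where
  toFun := τ.app U
  map_add' := map_add _
  map_smul' := τ.app_smul

/-- Monomorphisms of `𝒪_X`-modules are the morphisms that are injective on sections. -/
lemma mono_iff_injective_app {F G : X.Modules} (τ : F ⟶ G) :
    Mono τ ↔ ∀ U, Function.Injective (τ.app U) := by
  rw [← (toPresheaf X).mono_map_iff_mono, NatTrans.mono_iff_mono_app]
  simp only [AddCommGrpCat.mono_iff_injective]
  exact ⟨fun h U ↦ h (op U), fun h U ↦ h U.unop⟩

/-- Sheafification turns a morphism of presheaves of modules into a monomorphism if and only if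
the morphism is locally injective. -/
lemma mono_sheafification_map_iff {P Q : X.PresheafOfModules} (f : P ⟶ Q) :
    Mono (C := X.Modules)
      ((_root_.PresheafOfModules.sheafification (𝟙 X.ringCatSheaf.obj)).map f) ↔
      Presheaf.IsLocallyInjective (Opens.grothendieckTopology X)
        ((_root_.PresheafOfModules.toPresheaf _).map f) := by
  rw [← Presheaf.isLocallyInjective_presheafToSheaf_map_iff,
    Sheaf.isLocallyInjective_iff_injective]
  exact (mono_iff_injective_app (X := X) _).trans
    ⟨fun h U ↦ h U.unop, fun h U ↦ h (op U)⟩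

/-- Restriction of sections of the presheaf tensor product of two `𝒪_X`-modules. -/
noncomputable def tensorRestrict (M F : X.Modules) {U V : X.Opens} (i : V ⟶ U) :
    Γ(M, U) ⊗[Γ(X, U)] Γ(F, U) →+ Γ(M, V) ⊗[Γ(X, V)] Γ(F, V) :=
  TensorProduct.liftAddHom
    { toFun m := { toFun s := M.presheaf.map i.op m ⊗ₜ F.presheaf.map i.op s
                   map_zero' := by simp
                   map_add' := by simp [tmul_add] }
      map_zero' := by ext; simp
      map_add' := fun _ _ ↦ by ext; simp [add_tmul] }
    (fun r m s ↦ by simp [smul_tmul])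

@[simp]
lemma tensorRestrict_tmul (M F : X.Modules) {U V : X.Opens} (i : V ⟶ U) (m : Γ(M, U))
    (s : Γ(F, U)) : tensorRestrict M F i (m ⊗ₜ s) =
      M.presheaf.map i.op m ⊗ₜ F.presheaf.map i.op s := rfl

lemma presheafTensorLeft_map_app_apply (M : X.Modules) {F G : X.Modules} (τ : F ⟶ G)
    (U : X.Opens) (t : Γ(M, U) ⊗[Γ(X, U)] Γ(F, U)) :
    ((_root_.PresheafOfModules.toPresheaf _).map
      ((presheafTensorLeft ((toPresheafOfModules X).obj M)).map
        ((toPresheafOfModules X).map τ))).app (op U) t =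
      (τ.appLinear U).lTensor Γ(M, U) t := by
  induction t with
  | zero => exact (map_zero _).trans (map_zero _).symm
  | add a b ha hb => exact (map_add _ a b).trans ((congrArg₂ _ ha hb).trans (map_add _ a b).symm)
  | tmul m s => rfl

lemma presheafTensorLeft_obj_map_apply (M F : X.Modules) {U V : X.Opens} (i : V ⟶ U)
    (t : Γ(M, U) ⊗[Γ(X, U)] Γ(F, U)) :
    ((_root_.PresheafOfModules.toPresheaf _).obj
      ((presheafTensorLeft ((toPresheafOfModules X).obj M)).obj
        ((toPresheafOfModules X).obj F))).map i.op t = tensorRestrict M F i t := by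
  induction t with
  | zero => exact (map_zero _).trans (map_zero _).symm
  | add a b ha hb => exact (map_add _ a b).trans ((congrArg₂ _ ha hb).trans (map_add _ a b).symm)
  | tmul m s => rfl

/-- Removes sheafification from the problem: by additivity, local injectivity only concerns sections
in the kernel. -/
lemma mono_tensorLeftFunctor_map_iff (M : X.Modules) {F G : X.Modules} (τ : F ⟶ G) :
    Mono (M.tensorLeftFunctor.map τ) ↔
      ∀ (U : X.Opens) (t : Γ(M, U) ⊗[Γ(X, U)] Γ(F, U)),
        (τ.appLinear U).lTensor Γ(M, U) t = 0 →
        ∀ x ∈ U, ∃ (V : X.Opens) (i : V ⟶ U), tensorRestrict M F i t = 0 ∧ x ∈ V := by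
  refine (mono_sheafification_map_iff _).trans ⟨fun ⟨h⟩ U t ht x hx ↦ ?_, fun h ↦ ⟨?_⟩⟩
  · obtain ⟨V, i, hi, hxV⟩ := h (X := op U) t (0 : Γ(M, U) ⊗[Γ(X, U)] Γ(F, U)) (by
      erw [presheafTensorLeft_map_app_apply, presheafTensorLeft_map_app_apply, ht, map_zero]
      rfl) x hx
    refine ⟨V, i, ?_, hxV⟩
    erw [← presheafTensorLeft_obj_map_apply]
    exact hi.trans (map_zero _)
  · rintro ⟨U⟩ a b hab x hx
    obtain ⟨V, i, hi, hxV⟩ := h U (a - b) (by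
      erw [← presheafTensorLeft_map_app_apply]
      exact (map_sub _ a b).trans (sub_eq_zero.2 hab)) x hx
    refine ⟨V, i, ?_, hxV⟩
    erw [← presheafTensorLeft_obj_map_apply] at hi
    exact sub_eq_zero.1 ((map_sub _ a b).symm.trans hi)

lemma lTensor_tensorRestrict (M : X.Modules) {F G : X.Modules} (τ : F ⟶ G) {U V : X.Opens}
    (i : V ⟶ U) (t : Γ(M, U) ⊗[Γ(X, U)] Γ(F, U)) :
    (τ.appLinear V).lTensor Γ(M, V) (tensorRestrict M F i t) =
      tensorRestrict M G i ((τ.appLinear U).lTensor Γ(M, U) t) := by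
  induction t with
  | zero => simp
  | add a b ha hb => simp only [map_add, ha, hb]
  | tmul m s =>
    rw [tensorRestrict_tmul, LinearMap.lTensor_tmul, LinearMap.lTensor_tmul, tensorRestrict_tmul]
    exact congrArg (_ ⊗ₜ[Γ(X, V)] ·) congr($(τ.mapPresheaf.naturality i.op) s)

/-- A locally absolutely pure `𝒪_X`-module is absolutely pure among all `𝒪_X`-modules. -/
theorem IsLocallyAbsolutelyPure.isAbsolutelyPure {F : X.Modules} (hF : F.IsLocallyAbsolutelyPure) :
    F.IsAbsolutelyPure := by
  intro G τ hτ
  refine ⟨hτ, fun M ↦ (mono_tensorLeftFunctor_map_iff M τ).2 fun U t ht x hx ↦ ?_⟩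
  obtain ⟨V, hV, hxV, hVU⟩ := X.isBasis_affineOpens.exists_subset_of_mem_open hx U.2
  obtain ⟨V, hV, rfl⟩ := hV
  refine ⟨V, homOfLE hVU, ?_, hxV⟩
  refine hF V hV _ (τ.appLinear V) ((mono_iff_injective_app τ).1 hτ V) Γ(M, V) ?_
  rw [lTensor_tensorRestrict, ht, map_zero, map_zero]

/-! ### Stalks of quasi-coherent modules over affine opens -/

noncomputable instance moduleStalk (F : X.Modules) (x : X) :
    Module (X.presheaf.stalk x) (F.presheaf.stalk x) :=
  _root_.PresheafOfModules.instModuleCarrierStalkCommRingCatCarrierAbPresheafOpensCarrier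
    (R := X.presheaf) ((toPresheafOfModules X).obj F) x

/-- The germ map of an `𝒪_X`-module, as a semilinear map. -/
noncomputable def germLinear (F : X.Modules) (U : X.Opens) (x : X) (hx : x ∈ U) :
    Γ(F, U) →ₛₗ[(X.presheaf.germ U x hx).hom] F.presheaf.stalk x where
  toFun := F.presheaf.germ U x hx
  map_add' := map_add _
  map_smul' r m := _root_.PresheafOfModules.germ_smul (R := X.presheaf)
    ((toPresheafOfModules X).obj F) x U hx r m

lemma germLinear_apply (F : X.Modules) (U : X.Opens) (x : X) (hx : x ∈ U) (s : Γ(F, U)) :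
    F.germLinear U x hx s = F.presheaf.germ U x hx s := rfl

/-- Matches the two scalar actions of `Γ(X, U)`, through `Spec` and through restriction on `X`. -/
lemma ΓSpecIso_inv_map_appIso_inv {U : X.Opens} (hU : IsAffineOpen U)
    (V : (Spec Γ(X, U)).Opens) (hV : hU.fromSpec ''ᵁ V ≤ U) :
    (ΓSpecIso Γ(X, U)).inv ≫ (Spec Γ(X, U)).presheaf.map V.leTop.op ≫
      (hU.fromSpec.appIso V).inv = X.presheaf.map (homOfLE hV).op := by
  rw [← Category.assoc, Iso.comp_inv_eq, Scheme.Hom.appIso_hom', Scheme.Hom.map_appLE,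
    Scheme.Hom.appLE, hU.fromSpec_app_self, Category.assoc, ← Functor.map_comp]
  rfl

lemma restrict_fromSpec_smul (F : X.Modules) {U : X.Opens} (hU : IsAffineOpen U)
    (V : (Spec Γ(X, U)).Opens) (hV : hU.fromSpec ''ᵁ V ≤ U) (r : Γ(X, U))
    (m : Γ(F.restrict hU.fromSpec, V)) :
    (F.restrictAppIso hU.fromSpec V).hom (r • m) =
      X.presheaf.map (homOfLE hV).op r • (F.restrictAppIso hU.fromSpec V).hom m := by
  rw [smul_Spec_def]
  erw [smul_restrictAppIso_hom_apply]
  rw [← ΓSpecIso_inv_map_appIso_inv hU V hV]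
  rfl

lemma mem_basicOpen_pow {U : X.Opens} {f : Γ(X, U)} {x : X} (n : ℕ) (hx : x ∈ X.basicOpen f) :
    x ∈ X.basicOpen (f ^ n) := by
  have hxU := X.basicOpen_le f hx
  rw [X.mem_basicOpen _ _ hxU] at hx ⊢
  rw [map_pow]
  exact hx.pow n

section Quasicoherent

variable (F : X.Modules) [F.IsQuasicoherent] {U : X.Opens} (hU : IsAffineOpen U)

include hU

lemma isLocalizing_restrict_fromSpec :
    IsLocalizing (modulesSpecToSheaf.obj (F.restrict hU.fromSpec)) :=
  (isIso_fromTildeΓ_iff_isLocalizing _).1 inferInstance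

/-- The kernel half of `F(D(f)) = F(U)_f`, transported from `Spec Γ(X, U)`. -/
lemma exists_pow_smul_eq_zero (f : Γ(X, U)) (s : Γ(F, U))
    (hs : F.presheaf.map (homOfLE (X.basicOpen_le f)).op s = 0) : ∃ n : ℕ, f ^ n • s = 0 := by
  have hT : hU.fromSpec ''ᵁ ⊤ = U := by simp
  have hD : hU.fromSpec ''ᵁ PrimeSpectrum.basicOpen f ≤ X.basicOpen f :=
    (hU.fromSpec_image_basicOpen f).le
  let s' : Γ(F.restrict hU.fromSpec, ⊤) := F.presheaf.map (homOfLE hT.le).op s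
  have hs' : F.presheaf.map (homOfLE hD).op
      (F.presheaf.map (homOfLE (X.basicOpen_le f)).op s) = 0 := by rw [hs, map_zero]
  rw [← ConcreteCategory.comp_apply, ← Functor.map_comp] at hs'
  have hs'' : F.presheaf.map (hU.fromSpec.opensFunctor.map (PrimeSpectrum.basicOpen f).leTop).op
      (F.presheaf.map (homOfLE hT.le).op s) = 0 := by
    rw [← ConcreteCategory.comp_apply, ← Functor.map_comp]
    exact hs'
  obtain ⟨-, -, h⟩ := (isLocalizedModule_iff _ _).1 (isLocalizing_restrict_fromSpec F hU f)
  obtain ⟨⟨_, n, rfl⟩, hn⟩ := h (x₁ := s') (x₂ := 0) (hs''.trans (map_zero _).symm)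
  refine ⟨n, ?_⟩
  have hn' : X.presheaf.map (homOfLE hT.le).op (f ^ n) • F.presheaf.map (homOfLE hT.le).op s = 0 :=
    (restrict_fromSpec_smul F hU ⊤ hT.le (f ^ n) s').symm.trans
      ((congrArg _ (hn.trans (smul_zero _))).trans (map_zero _))
  rw [← map_smul] at hn'
  have hbij := ConcreteCategory.bijective_of_isIso (F.presheaf.map (eqToHom hT).op)
  exact hbij.1 (hn'.trans (map_zero _).symm)

/-- The surjectivity half of the same localization. -/
lemma exists_map_eq_pow_smul (f : Γ(X, U)) (s : Γ(F, X.basicOpen f)) :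
    ∃ (n : ℕ) (a : Γ(F, U)), F.presheaf.map (homOfLE (X.basicOpen_le f)).op a =
      X.presheaf.map (homOfLE (X.basicOpen_le f)).op (f ^ n) • s := by
  have hT : hU.fromSpec ''ᵁ ⊤ = U := by simp
  have hD : hU.fromSpec ''ᵁ PrimeSpectrum.basicOpen f = X.basicOpen f :=
    hU.fromSpec_image_basicOpen f
  obtain ⟨-, h, -⟩ := (isLocalizedModule_iff _ _).1 (isLocalizing_restrict_fromSpec F hU f)
  let s' : Γ(F.restrict hU.fromSpec, PrimeSpectrum.basicOpen f) :=
    F.presheaf.map (homOfLE hD.le).op s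
  obtain ⟨⟨a, ⟨_, n, rfl⟩⟩, ha⟩ := h s'
  obtain ⟨a, rfl⟩ := (ConcreteCategory.bijective_of_isIso (F.presheaf.map (eqToHom hT).op)).2 a
  refine ⟨n, a, ?_⟩
  have ha' : X.presheaf.map (homOfLE (hD.le.trans (X.basicOpen_le f))).op (f ^ n) •
      F.presheaf.map (homOfLE hD.le).op s =
      F.presheaf.map (hU.fromSpec.opensFunctor.map (PrimeSpectrum.basicOpen f).leTop).op
        (F.presheaf.map (eqToHom hT).op a) :=
    (restrict_fromSpec_smul F hU _ (hD.le.trans (X.basicOpen_le f)) (f ^ n) s').symm.trans ha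
  refine (ConcreteCategory.bijective_of_isIso (F.presheaf.map (eqToHom hD).op)).1 ?_
  rw [map_smul, ← ConcreteCategory.comp_apply, ← ConcreteCategory.comp_apply, ← Functor.map_comp,
    ← Functor.map_comp]
  rw [← ConcreteCategory.comp_apply, ← Functor.map_comp] at ha'
  exact ha'.symm

lemma exists_smul_eq_zero_of_germ_eq_zero (x : X) (hx : x ∈ U) (s : Γ(F, U))
    (hs : F.presheaf.germ U x hx s = 0) :
    ∃ r : Γ(X, U), x ∈ X.basicOpen r ∧ r • s = 0 := by
  obtain ⟨W, hxW, i, j, hW⟩ := F.presheaf.germ_eq x hx hx s 0 (hs.trans (map_zero _).symm)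
  obtain ⟨f, hfW, hxf⟩ := hU.exists_basicOpen_le ⟨x, hxW⟩ hx
  obtain ⟨n, hn⟩ := F.exists_pow_smul_eq_zero hU f s (by
    rw [show homOfLE (X.basicOpen_le f) = homOfLE hfW ≫ i from rfl, op_comp, Functor.map_comp,
      ConcreteCategory.comp_apply, hW, map_zero, map_zero])
  exact ⟨f ^ n, mem_basicOpen_pow n hxf, hn⟩

lemma exists_germ_smul_eq_germ (x : X) (hx : x ∈ U) (y : F.presheaf.stalk x) :
    ∃ r : Γ(X, U), x ∈ X.basicOpen r ∧
      ∃ a : Γ(F, U), X.presheaf.germ U x hx r • y = F.presheaf.germ U x hx a := by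
  obtain ⟨W, hxW, s, rfl⟩ := F.presheaf.exists_germ_eq y
  obtain ⟨f, hfW, hxf⟩ := hU.exists_basicOpen_le ⟨x, hxW⟩ hx
  obtain ⟨n, a, ha⟩ := F.exists_map_eq_pow_smul hU f (F.presheaf.map (homOfLE hfW).op s)
  refine ⟨f ^ n, mem_basicOpen_pow n hxf, a, ?_⟩
  have h := congrArg (F.germLinear _ x hxf) ha
  rw [LinearMap.map_smulₛₗ] at h
  simp only [germLinear_apply, TopCat.Presheaf.germ_res_apply] at h
  rw [h]

/-- The germ maps of a quasi-coherent module over an affine open are localizations. -/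
lemma isLocalizationAt_germLinear (x : X) (hx : x ∈ U) :
    (F.germLinear U x hx).IsLocalizationAt (hU.primeIdealOf ⟨x, hx⟩).asIdeal.primeCompl := by
  let := X.presheaf.algebra_section_stalk ⟨x, hx⟩
  have hloc := hU.isLocalization_stalk ⟨x, hx⟩
  have hmem (r : Γ(X, U)) (hr : x ∈ X.basicOpen r) :
      r ∈ (hU.primeIdealOf ⟨x, hx⟩).asIdeal.primeCompl :=
    (IsLocalization.AtPrime.isUnit_to_map_iff
      (X.presheaf.stalk (⟨x, hx⟩ : U).1) (hU.primeIdealOf ⟨x, hx⟩).asIdeal r).1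
      ((X.mem_basicOpen r x hx).1 hr)
  refine ⟨hloc, fun y ↦ ?_, fun a ha ↦ ?_⟩
  · obtain ⟨r, hr, a, ha⟩ := F.exists_germ_smul_eq_germ hU x hx y
    exact ⟨r, hmem r hr, a, ha⟩
  · obtain ⟨r, hr, h⟩ := F.exists_smul_eq_zero_of_germ_eq_zero hU x hx a ha
    exact ⟨r, hmem r hr, h⟩

end Quasicoherent


end AlgebraicGeometry.Scheme.Modules

/-! ### Products of skyscrapers and the converse -/

namespace AlgebraicGeometry.Scheme.Modules

variable {X : Scheme.{u}} (N : ∀ x : X, ModuleCat.{u} (X.presheaf.stalk x))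

/-- The presheaf of abelian groups `U ↦ ∏ x ∈ U, N x`. -/
noncomputable def piPresheaf : TopCat.Presheaf Ab.{u} X where
  obj U := AddCommGrpCat.of (∀ x : U.unop, N x.1)
  map i := AddCommGrpCat.ofHom
    { toFun s x := s ⟨x.1, i.unop.le x.2⟩
      map_zero' := rfl
      map_add' _ _ := rfl }

/-- The module structure on `∏ x ∈ U, N x` given by the germ maps. -/
noncomputable abbrev piModule (U : X.Opens) : Module Γ(X, U) (∀ x : U, N x.1) where
  smul r s x := X.presheaf.germ U x.1 x.2 r • s x
  one_smul s := funext fun x ↦ by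
    change X.presheaf.germ U x.1 x.2 1 • s x = s x
    rw [map_one, one_smul]
  mul_smul a b s := funext fun x ↦ by
    change X.presheaf.germ U x.1 x.2 (a * b) • s x =
      X.presheaf.germ U x.1 x.2 a • X.presheaf.germ U x.1 x.2 b • s x
    rw [map_mul, mul_smul]
  smul_zero r := funext fun x ↦ smul_zero (X.presheaf.germ U x.1 x.2 r)
  smul_add r s t := funext fun x ↦ smul_add (X.presheaf.germ U x.1 x.2 r) (s x) (t x)
  add_smul a b s := funext fun x ↦ by
    change X.presheaf.germ U x.1 x.2 (a + b) • s x =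
      X.presheaf.germ U x.1 x.2 a • s x + X.presheaf.germ U x.1 x.2 b • s x
    rw [map_add, add_smul]
  zero_smul s := funext fun x ↦ by
    change X.presheaf.germ U x.1 x.2 0 • s x = 0
    rw [map_zero, zero_smul]

noncomputable instance (U : (Opens X)ᵒᵖ) :
    Module (X.ringCatSheaf.obj.obj U) ((piPresheaf N).obj U) :=
  piModule N U.unop

/-- The `𝒪_X`-module `U ↦ ∏ x ∈ U, N x`, the product of the skyscraper sheaves of the `N x`. -/
noncomputable def piSkyscraper : X.Modules where
  val := _root_.PresheafOfModules.ofPresheaf (piPresheaf N) (fun U V i r m ↦ by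
    funext x
    exact (congrArg (fun a : X.presheaf.stalk x.1 ↦
      a • (show ∀ x : U.unop, N x.1 from m) ⟨x.1, i.unop.le x.2⟩)
      (X.presheaf.germ_res_apply i.unop x.1 x.2 r)).symm)
  -- The underlying presheaf of sets consists of all dependent functions.
  isSheaf := (TopCat.Presheaf.isSheaf_iff_isSheaf_comp (CategoryTheory.forget Ab) _).2
    (TopCat.Presheaf.toTypes_isSheaf X fun x ↦ N x)

/-- Evaluation of sections of `piSkyscraper N` at a point. -/
noncomputable def piSkyscraperEval (U : X.Opens) (x : X) (hx : x ∈ U) :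
    Γ(piSkyscraper N, U) →ₛₗ[(X.presheaf.germ U x hx).hom] N x where
  toFun s := (show ∀ x : U, N x.1 from s) ⟨x, hx⟩
  map_add' _ _ := rfl
  map_smul' _ _ := rfl

variable {N}

/-- A family of linear maps on stalks induces a morphism into the product of skyscrapers. -/
noncomputable def toPiSkyscraper {F : X.Modules}
    (φ : ∀ x, F.presheaf.stalk x →ₗ[X.presheaf.stalk x] N x) : F ⟶ piSkyscraper N :=
  SheafOfModules.Hom.mk <| _root_.PresheafOfModules.homMk
    { app U := AddCommGrpCat.ofHom
        { toFun s := (fun x : U.unop ↦ φ x.1 (F.presheaf.germ U.unop x.1 x.2 s))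
          map_zero' := by
            funext x
            exact (congrArg (φ x.1) (map_zero _)).trans (map_zero _)
          map_add' a b := by
            funext x
            exact (congrArg (φ x.1) (map_add _ a b)).trans (map_add _ _ _) }
      naturality U V i := by
        ext s
        funext x
        exact congrArg (φ x.1) (F.presheaf.germ_res_apply i.unop x.1 x.2 s) } (fun U r s ↦ by
    funext x
    exact (congrArg (φ x.1) ((F.germLinear U.unop x.1 x.2).map_smulₛₗ r s)).trans
      ((φ x.1).map_smul _ _))

lemma piSkyscraper_ext {U : X.Opens} {s t : Γ(piSkyscraper N, U)}
    (h : ∀ x hx, piSkyscraperEval N U x hx s = piSkyscraperEval N U x hx t) : s = t :=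
  funext fun x ↦ h x.1 x.2

lemma mono_toPiSkyscraper {F : X.Modules}
    (φ : ∀ x, F.presheaf.stalk x →ₗ[X.presheaf.stalk x] N x)
    (hφ : ∀ x, Function.Injective (φ x)) : Mono (toPiSkyscraper φ) := by
  refine (mono_iff_injective_app _).2 fun U s t h ↦ ?_
  refine TopCat.Presheaf.section_ext ⟨F.presheaf, F.isSheaf⟩ U s t fun x hx ↦ hφ x ?_
  exact congrArg (piSkyscraperEval N U x hx) h

/-- A family of semilinear maps induces a linear map into sections of a product of skyscrapers. -/
noncomputable def liftPiSkyscraper {U : X.Opens} {B : Type u} [AddCommGroup B] [Module Γ(X, U) B]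
    (β : ∀ x (hx : x ∈ U), B →ₛₗ[(X.presheaf.germ U x hx).hom] N x) :
    B →ₗ[Γ(X, U)] Γ(piSkyscraper N, U) where
  toFun b := (fun x : U ↦ β x.1 x.2 b)
  map_add' a b := funext fun x ↦ map_add (β x.1 x.2) a b
  map_smul' r b := funext fun x ↦ (β x.1 x.2).map_smulₛₗ r b

/-- Passing to the stalk of a tensor product with a product of skyscrapers is compatible with
restriction. -/
lemma map_eval_germ_tensorRestrict (F : X.Modules) {U V : X.Opens} (i : V ⟶ U) (x : X)
    (hx : x ∈ V) (t : Γ(piSkyscraper N, U) ⊗[Γ(X, U)] Γ(F, U)) :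
    TensorProduct.map (piSkyscraperEval N V x hx) (F.germLinear V x hx)
      (tensorRestrict (piSkyscraper N) F i t) =
    TensorProduct.map (piSkyscraperEval N U x (i.le hx)) (F.germLinear U x (i.le hx)) t := by
  induction t with
  | zero => simp
  | add a b ha hb => simp only [map_add, ha, hb]
  | tmul m s =>
    rw [tensorRestrict_tmul, TensorProduct.map_tmul, TensorProduct.map_tmul]
    exact congrArg (piSkyscraperEval N U x (i.le hx) m ⊗ₜ[X.presheaf.stalk x] ·)
      (F.presheaf.germ_res_apply i x hx s)

/-- A quasi-coherent module that is absolutely pure among all `𝒪_X`-modules is locally absolutely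
pure. -/
theorem IsAbsolutelyPure.isLocallyAbsolutelyPure {F : X.Modules} [F.IsQuasicoherent]
    (hF : F.IsAbsolutelyPure) : F.IsLocallyAbsolutelyPure := by
  intro U hU B _ _ ι hι T _ _
  rw [injective_iff_map_eq_zero]
  intro t ht
  -- The condition `x ∈ U` comes after `N` and `φ`, so that they form families on all of `X`; off
  -- `U` the identity of the stalk serves.
  have hN (x : X) : ∃ (N : ModuleCat.{u} (X.presheaf.stalk x))
      (φ : F.presheaf.stalk x →ₗ[X.presheaf.stalk x] N), Function.Injective φ ∧
      ∀ hx : x ∈ U, ∃ β : B →ₛₗ[(X.presheaf.germ U x hx).hom] N,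
        ∀ a, β (ι a) = φ (F.presheaf.germ U x hx a) := by
    by_cases hx : x ∈ U
    · obtain ⟨N, φ, β, hφ, h⟩ := (F.isLocalizationAt_germLinear hU x hx).exists_extension ι hι
      exact ⟨N, φ, hφ, fun _ ↦ ⟨β, h⟩⟩
    · exact ⟨ModuleCat.of _ (F.presheaf.stalk x), LinearMap.id, Function.injective_id,
        fun h ↦ absurd h hx⟩
  have hT (x : X) : ∃ T' : ModuleCat.{u} (X.presheaf.stalk x),
      ∀ hx : x ∈ U, ∃ θ : T →ₛₗ[(X.presheaf.germ U x hx).hom] T', ∀ t : T ⊗[Γ(X, U)] Γ(F, U),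
        TensorProduct.map θ (F.germLinear U x hx) t = 0 →
          ∃ s ∉ (hU.primeIdealOf ⟨x, hx⟩).asIdeal, s • t = 0 := by
    by_cases hx : x ∈ U
    · obtain ⟨T', θ, h⟩ := (F.isLocalizationAt_germLinear hU x hx).exists_semilinearMap T
      exact ⟨T', fun _ ↦ ⟨θ, h⟩⟩
    · exact ⟨ModuleCat.of _ PUnit, fun h ↦ absurd h hx⟩
  choose N φ hφ β hβ using hN
  choose T' θ hθ using hT
  let t' : Γ(piSkyscraper T', U) ⊗[Γ(X, U)] Γ(F, U) := (liftPiSkyscraper θ).rTensor _ t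
  -- The factorization through `B` is what transfers the vanishing of `t` in `T ⊗ B`.
  have hτ : (toPiSkyscraper φ).appLinear U = liftPiSkyscraper β ∘ₗ ι :=
    LinearMap.ext fun a ↦ piSkyscraper_ext fun x hx ↦ (hβ x hx a).symm
  have ht' : ((toPiSkyscraper φ).appLinear U).lTensor _ t' = 0 := by
    rw [hτ, ← LinearMap.comp_apply, LinearMap.lTensor_comp_rTensor, ← LinearMap.rTensor_comp_lTensor,
      LinearMap.lTensor_comp, LinearMap.comp_apply, LinearMap.comp_apply, ht, map_zero, map_zero]
  have hann (x : X) (hx : x ∈ U) :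
      ∃ s ∉ (hU.primeIdealOf ⟨x, hx⟩).asIdeal, s • t = 0 := by
    obtain ⟨V, i, hV, hxV⟩ := (mono_tensorLeftFunctor_map_iff _ _).1
      ((hF _ _ (mono_toPiSkyscraper φ hφ)).2 (piSkyscraper T')) U t' ht' x hx
    refine hθ x hx t ?_
    have h := map_eval_germ_tensorRestrict F i x hxV t'
    rw [hV, map_zero] at h
    refine Eq.trans ?_ h.symm
    clear * -
    change _ = TensorProduct.map _ _ ((liftPiSkyscraper θ).rTensor _ t)
    induction t with
    | zero => simp
    | add a b ha hb => simp only [map_add, ha, hb]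
    | tmul m s => rfl
  -- A maximal ideal containing the annihilator of `t` would be a point of `U`, against `hann`.
  by_contra hne
  obtain ⟨p, hp, hle⟩ := Ideal.exists_le_maximal (Ideal.torsionOf Γ(X, U) _ t)
    (by rwa [Ne, Ideal.torsionOf_eq_top_iff])
  obtain ⟨x, hx⟩ : ∃ x : U, hU.primeIdealOf x = ⟨p, hp.isPrime⟩ :=
    hU.isoSpec.hom.surjective ⟨p, hp.isPrime⟩
  obtain ⟨s, hs, hst⟩ := hann x.1 x.2
  refine hs ?_
  rw [hx]
  exact hle hst

end AlgebraicGeometry.Scheme.Modules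

end

theorem mainTheorem9 (X : AlgebraicGeometry.Scheme.{u}) (hX : X.IsLocallyCoherent)
    (F : X.Modules) (hF : F.IsQuasicoherent) :
    F.IsLocallyAbsolutelyPure ↔ F.IsAbsolutelyPure := by
  exact ⟨fun h ↦ h.isAbsolutelyPure, fun h ↦ h.isLocallyAbsolutelyPure⟩
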